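/- Let $\mathbb{C}((x))$ be the field of formal Laurent series over $\mathbb{C}$, the fraction field of $\mathbb{C}[[x]]$. Inside the field of formal series $\sum_q c_q x^q$ with complex coefficients, rational exponents and well-ordered support, let $x^{1/n}$ ($n\ge 1$) be the standard $n$-th root of $x$, let $\mathbb{C}((x))(x^{1/n})$ be the field obtained by adjoining it to $\mathbb{C}((x))$, let $\mathbb{C}[[x^{1/n}]]$ be the ring of all series $\sum_{k\ge 0} c_k x^{k/n}$ with $c_k \in \mathbb{C}$, and let $$L^{*}=\bigcup_{n\ge 1}\mathbb{C}((x))(x^{1/n}).$$ **Theorem.** Every monic polynomial $h=y^{d}+h_{1}y^{d-1}+\cdots+h_{d}$ with coefficients $h_i\in L^{*}$ can be factored into linear factors $h=(y-\sigma_{1})\cdots(y-\sigma_{d})$ with $\sigma_{i}\in L^{*}$. Moreover, if each $h_{i}$ belongs to $\mathbb{C}[[x]]$, then there exists an integer $n\ge 1$ such that all $\sigma_{i}$ belong to $\mathbb{C}[[x^{1/n}]]$. -/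

import Mathlib

noncomputable section

namespace Puiseux

/-- The ambient field: Hahn series `∑ c_q x^q` with complex coefficients and rational exponents.
It contains `ℂ((x))` together with a compatible system of roots `x^{1/n}`. -/
abbrev Ambient : Type := HahnSeries ℚ ℂ

/-- The additive map `k ↦ k / n` from the integers to the rationals. -/
def scaleExp (n : ℕ+) : ℤ →+ ℚ where
  toFun k := (k : ℚ) / ((n : ℕ) : ℚ)
  map_zero' := by simp
  map_add' a b := by push_cast; ring

theorem scaleExp_le_iff (n : ℕ+) (a b : ℤ) : scaleExp n a ≤ scaleExp n b ↔ a ≤ b := by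
  have hn : (0 : ℚ) < ((n : ℕ) : ℚ) := by exact_mod_cast n.pos
  change (a : ℚ) / ((n : ℕ) : ℚ) ≤ (b : ℚ) / ((n : ℕ) : ℚ) ↔ a ≤ b
  rw [div_le_div_iff_of_pos_right hn]
  exact Int.cast_le

theorem scaleExp_injective (n : ℕ+) : Function.Injective (scaleExp n) := fun a b hab =>
  le_antisymm ((scaleExp_le_iff n a b).1 hab.le) ((scaleExp_le_iff n b a).1 hab.ge)

/-- Substitution of `x^{1/n}` in a formal Laurent series: `∑ c_k t^k ↦ ∑ c_k x^{k/n}`. -/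
def substRoot (n : ℕ+) : LaurentSeries ℂ →+* Ambient :=
  HahnSeries.embDomainRingHom (scaleExp n) (scaleExp_injective n) (scaleExp_le_iff n)

/-- The `n`-th root `x^{1/n}` of `x`. -/
def xRoot (n : ℕ+) : Ambient := HahnSeries.single (1 / ((n : ℕ) : ℚ)) 1

/-- The field `L = ℂ((x))` of formal Laurent series in `x`. -/
def laurentField : Subfield Ambient := (substRoot 1).fieldRange

/-- The field `L(x^{1/n})`, obtained from `L = ℂ((x))` by adjoining `x^{1/n}`. -/
def rootField (n : ℕ+) : Subfield Ambient :=
  Subfield.closure ((laurentField : Set Ambient) ∪ {xRoot n})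

theorem xRoot_pow (n m : ℕ+) : xRoot (n * m) ^ (m : ℕ) = xRoot n := by
  have hn : ((n : ℕ) : ℚ) ≠ 0 := by exact_mod_cast n.ne_zero
  have hm : ((m : ℕ) : ℚ) ≠ 0 := by exact_mod_cast m.ne_zero
  simp only [xRoot, HahnSeries.single_pow, one_pow, PNat.mul_coe, Nat.cast_mul, nsmul_eq_mul]
  congr 2
  field_simp

theorem rootField_le_mul (n m : ℕ+) : rootField n ≤ rootField (n * m) := by
  refine Subfield.closure_le.2 (Set.union_subset (fun z hz => ?_) ?_)
  · exact Subfield.subset_closure (Or.inl hz)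
  · have hx : xRoot (n * m) ∈ rootField (n * m) :=
      Subfield.subset_closure (Or.inr (Set.mem_singleton _))
    rw [Set.singleton_subset_iff, SetLike.mem_coe, ← xRoot_pow n m]
    exact pow_mem hx _

theorem directed_rootField : Directed (· ≤ ·) rootField := fun n m =>
  ⟨n * m, rootField_le_mul n m, by rw [mul_comm n m]; exact rootField_le_mul m n⟩

/-- The field `L* = ⋃ₙ L(x^{1/n})`, the union over all integers `n ≥ 1`. -/
def puiseuxField : Subfield Ambient where
  carrier := ⋃ n : ℕ+, (rootField n : Set Ambient)
  mul_mem' := by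
    rw [← Subfield.coe_iSup_of_directed directed_rootField]; exact mul_mem
  one_mem' := by
    rw [← Subfield.coe_iSup_of_directed directed_rootField]; exact one_mem _
  add_mem' := by
    rw [← Subfield.coe_iSup_of_directed directed_rootField]; exact add_mem
  zero_mem' := by
    rw [← Subfield.coe_iSup_of_directed directed_rootField]; exact zero_mem _
  neg_mem' := by
    rw [← Subfield.coe_iSup_of_directed directed_rootField]; exact neg_mem
  inv_mem' := by
    rw [← Subfield.coe_iSup_of_directed directed_rootField]; exact fun _ => inv_mem

/-- The ring `ℂ[[x^{1/n}]]` of formal power series in `x^{1/n}`, i.e. the set of all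
`∑_{k ≥ 0} c_k x^{k/n}`. For `n = 1` it is `ℂ[[x]]`. -/
def powerSeriesRing (n : ℕ+) : Subring Ambient :=
  ((substRoot n).comp (HahnSeries.ofPowerSeries ℤ ℂ)).range

end Puiseux

end

/-! ### Supports of Puiseux series and the fields $\mathbb{C}((x))(x^{1/n})$ -/

noncomputable section

namespace Puiseux

/-! The core is that a monic $f$ over $\mathbb{C}[[t]]$, $t=x^{1/n}$, of positive degree $d$ has a
Puiseux root, by strong induction on $d$ for all $n$ at once (`hasRootsBelow`). A shift of the
variable kills the coefficient of $y^{d-1}$. If $f\ne y^d$, the smallest Newton slope $v/k$ gives a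
substitution $t\mapsto t^k$ and a scaling of the roots by $t^v$ after which some coefficient below
the top is a unit (`exists_scaleRoots`). The reduction mod $t$ is then not a $d$-th power of a
linear form, so Weierstrass preparation at one of its roots yields a monic factor of smaller
positive degree (`Polynomial.exists_monic_dvd_of_residue`).

Clearing denominators by scaling roots makes $L^*$ algebraically closed. For coefficients in
$\mathbb{C}[[x]]$ the roots are integral, hence have no negative exponents, and finitely many roots
share one $n$. -/

theorem substRoot_coeff (n : ℕ+) (f : LaurentSeries ℂ) (k : ℤ) :
    (substRoot n f).coeff ((k : ℚ) / ((n : ℕ) : ℚ)) = f.coeff k :=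
  HahnSeries.embDomain_mk_coeff (scaleExp_injective n) _

theorem substRoot_coeff_of_notMem (n : ℕ+) (f : LaurentSeries ℂ) {q : ℚ}
    (hq : ∀ k : ℤ, (k : ℚ) / ((n : ℕ) : ℚ) ≠ q) : (substRoot n f).coeff q = 0 :=
  HahnSeries.embDomain_of_notMem_range (by rintro ⟨k, rfl⟩; exact hq k rfl)

theorem mem_range_substRoot (n : ℕ+) (y : Ambient) :
    y ∈ (substRoot n).fieldRange ↔
      ∀ q, y.coeff q ≠ 0 → ∃ k : ℤ, (k : ℚ) / ((n : ℕ) : ℚ) = q := by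
  constructor
  · rintro ⟨f, rfl⟩ q hq
    by_contra! h
    exact hq (substRoot_coeff_of_notMem n f h)
  · intro h
    refine ⟨⟨fun k => y.coeff (scaleExp n k), ?_⟩, ?_⟩
    -- `scaleExp n` is an order embedding, so the partial well-order of the support pulls back along
    -- it.
    · have := y.isPWO_support
      have hm : StrictMono (scaleExp n) := fun a b hab =>
        lt_of_le_not_ge ((scaleExp_le_iff n a b).2 hab.le)
          fun hba => hab.not_ge ((scaleExp_le_iff n b a).1 hba)
      intro s
      obtain ⟨a, b, hab, hle⟩ := this (fun k => ⟨scaleExp n (s k), (s k).2⟩)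
      exact ⟨a, b, hab, (scaleExp_le_iff n _ _).1 hle⟩
    · ext q
      by_cases hq : ∃ k : ℤ, (k : ℚ) / ((n : ℕ) : ℚ) = q
      · obtain ⟨k, rfl⟩ := hq
        rw [substRoot_coeff]; rfl
      · rw [substRoot_coeff_of_notMem n _ (by simpa using hq)]
        by_contra h0
        exact hq (h q (Ne.symm h0))

theorem range_substRoot_le_mul (n m : ℕ+) :
    (substRoot n).fieldRange ≤ (substRoot (n * m)).fieldRange := by
  intro y hy
  rw [mem_range_substRoot] at hy ⊢
  intro q hq
  obtain ⟨k, rfl⟩ := hy q hq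
  refine ⟨k * m, ?_⟩
  have hm : ((m : ℕ) : ℚ) ≠ 0 := by exact_mod_cast m.ne_zero
  push_cast
  rw [mul_div_mul_right _ _ hm]

/-- The embedding `∑ c_k t^k ↦ ∑ c_k x^{k/n}` of `ℂ[[t]]`. -/
def powerSubst (n : ℕ+) : PowerSeries ℂ →+* Ambient :=
  (substRoot n).comp (HahnSeries.ofPowerSeries ℤ ℂ)

theorem powerSubst_coeff (n : ℕ+) (p : PowerSeries ℂ) (k : ℕ) :
    (powerSubst n p).coeff ((k : ℚ) / ((n : ℕ) : ℚ)) = p.coeff k := by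
  have := substRoot_coeff n (HahnSeries.ofPowerSeries ℤ ℂ p) k
  rwa [HahnSeries.ofPowerSeries_apply_coeff, Int.cast_natCast] at this

theorem powerSubst_coeff_of_notMem (n : ℕ+) (p : PowerSeries ℂ) {q : ℚ}
    (hq : ∀ k : ℕ, (k : ℚ) / ((n : ℕ) : ℚ) ≠ q) : (powerSubst n p).coeff q = 0 := by
  by_cases h : ∃ k : ℤ, (k : ℚ) / ((n : ℕ) : ℚ) = q
  · obtain ⟨k, rfl⟩ := h
    refine (substRoot_coeff n (HahnSeries.ofPowerSeries ℤ ℂ p) k).trans ?_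
    rw [HahnSeries.ofPowerSeries_apply]
    refine HahnSeries.embDomain_of_notMem_range ?_
    rintro ⟨m, rfl⟩
    exact hq m (by simp)
  · exact substRoot_coeff_of_notMem n _ (by simpa using h)

theorem mem_powerSeriesRing (n : ℕ+) (y : Ambient) :
    y ∈ powerSeriesRing n ↔
      ∀ q, y.coeff q ≠ 0 → ∃ k : ℕ, (k : ℚ) / ((n : ℕ) : ℚ) = q := by
  constructor
  · rintro ⟨f, rfl⟩ q hq
    by_contra! h
    exact hq (powerSubst_coeff_of_notMem n f h)
  · intro h
    refine ⟨PowerSeries.mk fun k => y.coeff ((k : ℚ) / ((n : ℕ) : ℚ)), ?_⟩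
    change powerSubst n _ = y
    ext q
    by_cases hq : ∃ k : ℕ, (k : ℚ) / ((n : ℕ) : ℚ) = q
    · obtain ⟨k, rfl⟩ := hq
      rw [powerSubst_coeff, PowerSeries.coeff_mk]
    · rw [powerSubst_coeff_of_notMem n _ (by simpa using hq)]
      by_contra h0
      exact hq (h q (Ne.symm h0))

theorem powerSeriesRing_le_mul (n m : ℕ+) : powerSeriesRing n ≤ powerSeriesRing (n * m) := by
  intro y hy
  rw [mem_powerSeriesRing] at hy ⊢
  intro q hq
  obtain ⟨k, rfl⟩ := hy q hq
  refine ⟨k * m, ?_⟩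
  have hm : ((m : ℕ) : ℚ) ≠ 0 := by exact_mod_cast m.ne_zero
  push_cast
  rw [mul_div_mul_right _ _ hm]

theorem mem_powerSeriesRing_of_orderTop_nonneg {n : ℕ+} {y : Ambient}
    (hy : y ∈ (substRoot n).fieldRange) (h0 : 0 ≤ y.orderTop) : y ∈ powerSeriesRing n := by
  rw [mem_range_substRoot] at hy
  rw [mem_powerSeriesRing]
  intro q hq
  obtain ⟨k, rfl⟩ := hy q hq
  have h1 := h0.trans (HahnSeries.orderTop_le_of_coeff_ne_zero hq)
  have hn : (0 : ℚ) < ((n : ℕ) : ℚ) := by exact_mod_cast n.pos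
  have h2 : (0 : ℚ) ≤ (k : ℚ) / ((n : ℕ) : ℚ) := by exact_mod_cast h1
  have h3 : 0 ≤ k := by
    by_contra! h
    exact h2.not_gt (div_neg_of_neg_of_pos (by exact_mod_cast h) hn)
  exact ⟨k.toNat, by rw [← Int.cast_natCast (R := ℚ) k.toNat, Int.toNat_of_nonneg h3]⟩

theorem orderTop_nonneg_of_mem_powerSeriesRing {n : ℕ+} {y : Ambient}
    (hy : y ∈ powerSeriesRing n) : 0 ≤ y.orderTop := by
  rw [mem_powerSeriesRing] at hy
  refine HahnSeries.le_orderTop_iff_forall.2 fun q hq => ?_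
  by_contra h
  obtain ⟨k, rfl⟩ := hy q h
  have : (0 : ℚ) ≤ (k : ℚ) / ((n : ℕ) : ℚ) := by positivity
  exact absurd hq (not_lt.2 (by exact_mod_cast this))

theorem powerSubst_X (n : ℕ+) : powerSubst n PowerSeries.X = xRoot n := by
  refine (congrArg (substRoot n) HahnSeries.ofPowerSeries_X).trans ?_
  refine HahnSeries.embDomain_single.trans ?_
  simp [xRoot, scaleExp]

theorem powerSubst_expand (n m : ℕ+) (p : PowerSeries ℂ) :
    powerSubst (n * m) (PowerSeries.expand m m.ne_zero p) = powerSubst n p := by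
  have hm : ((m : ℕ) : ℚ) ≠ 0 := by exact_mod_cast m.ne_zero
  ext q
  by_cases hq : ∃ k : ℕ, (k : ℚ) / (((n * m : ℕ+) : ℕ) : ℚ) = q
  · obtain ⟨k, rfl⟩ := hq
    rw [powerSubst_coeff]
    by_cases hk : (m : ℕ) ∣ k
    · obtain ⟨l, rfl⟩ := hk
      rw [PowerSeries.coeff_expand_mul, ← powerSubst_coeff n p l]
      push_cast
      rw [mul_comm ((m : ℕ) : ℚ), mul_div_mul_right _ _ hm]
    · rw [PowerSeries.coeff_expand_of_not_dvd _ _ _ hk, powerSubst_coeff_of_notMem]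
      intro l hl
      apply hk
      have hn : ((n : ℕ) : ℚ) ≠ 0 := by exact_mod_cast n.ne_zero
      push_cast at hl
      field_simp at hl
      exact ⟨l, by exact_mod_cast (by linarith : (k : ℚ) = m * l)⟩
  · rw [powerSubst_coeff_of_notMem _ _ (by simpa using hq), powerSubst_coeff_of_notMem]
    intro l hl
    refine hq ⟨l * m, ?_⟩
    push_cast
    rw [mul_div_mul_right _ _ hm, hl]

/-- Sorting exponents by residue mod $n$ gives $p=\sum_{j<n}t^jp_j(t^n)$, and $p_j(t^n)$ becomes a
series in $x$. Thus adjoining $x^{1/n}$ algebraically already yields every power series in it. -/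
theorem powerSubst_mem_rootField (n : ℕ+) (p : PowerSeries ℂ) : powerSubst n p ∈ rootField n := by
  have hp : p = ∑ j ∈ Finset.range n, PowerSeries.X ^ j *
      PowerSeries.expand n n.ne_zero (PowerSeries.mk fun k => p.coeff (n * k + j)) := by
    ext i
    rw [map_sum, Finset.sum_eq_single (i % n)]
    · rw [PowerSeries.coeff_X_pow_mul', if_pos (Nat.mod_le _ _)]
      have : i - i % n = n * (i / n) := by have := Nat.div_add_mod i n; omega
      rw [this, PowerSeries.coeff_expand_mul, PowerSeries.coeff_mk, Nat.div_add_mod]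
    · intro j hj hne
      rw [PowerSeries.coeff_X_pow_mul']
      split_ifs with hji
      · refine PowerSeries.coeff_expand_of_not_dvd _ _ _ fun hd => hne ?_
        have := (Nat.modEq_iff_dvd' hji).2 hd
        rw [← Nat.mod_eq_of_lt (Finset.mem_range.1 hj)]
        exact this
      · rfl
    · intro h
      exact absurd (Finset.mem_range.2 (Nat.mod_lt _ n.pos)) h
  rw [hp, map_sum]
  refine sum_mem fun j _ => ?_
  rw [map_mul, map_pow, powerSubst_X]
  have hx : xRoot n ∈ rootField n := Subfield.subset_closure (Or.inr rfl)
  refine mul_mem (pow_mem hx _) (Subfield.subset_closure (Or.inl ?_))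
  have := powerSubst_expand 1 n (PowerSeries.mk fun k => p.coeff (n * k + j))
  rw [one_mul] at this
  rw [this]
  exact ⟨_, rfl⟩

theorem exists_powerSubst_eq_xRoot_pow_mul {n : ℕ+} {y : Ambient}
    (hy : y ∈ (substRoot n).fieldRange) : ∃ (N : ℕ) (p : PowerSeries ℂ),
      powerSubst n p = xRoot n ^ N * y := by
  obtain ⟨f, rfl⟩ := hy
  obtain ⟨N, hN⟩ : ∃ N : ℕ, 0 ≤ (N : ℤ) + f.order := ⟨f.order.natAbs, by omega⟩
  refine ⟨N, PowerSeries.X ^ ((N : ℤ) + f.order).toNat * f.powerSeriesPart, ?_⟩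
  have h1 : HahnSeries.ofPowerSeries ℤ ℂ
      (PowerSeries.X ^ ((N : ℤ) + f.order).toNat * f.powerSeriesPart) =
        HahnSeries.ofPowerSeries ℤ ℂ (PowerSeries.X ^ N) * f := by
    rw [map_mul, LaurentSeries.ofPowerSeries_powerSeriesPart, HahnSeries.ofPowerSeries_X_pow,
      HahnSeries.ofPowerSeries_X_pow, ← mul_assoc, HahnSeries.single_mul_single,
      Int.toNat_of_nonneg hN]
    simp
  rw [← powerSubst_X, ← map_pow, powerSubst, RingHom.comp_apply, RingHom.comp_apply, h1, map_mul]

theorem rootField_eq_range (n : ℕ+) : rootField n = (substRoot n).fieldRange := by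
  apply le_antisymm
  · refine Subfield.closure_le.2 (Set.union_subset ?_ ?_)
    · have := range_substRoot_le_mul 1 n
      rwa [one_mul] at this
    · rw [Set.singleton_subset_iff, ← powerSubst_X]
      exact ⟨_, rfl⟩
  · intro y hy
    obtain ⟨N, p, hp⟩ := exists_powerSubst_eq_xRoot_pow_mul hy
    have hx : xRoot n ∈ rootField n := Subfield.subset_closure (Or.inr rfl)
    have hx0 : xRoot n ≠ 0 := HahnSeries.single_ne_zero one_ne_zero
    rw [← inv_mul_cancel_left₀ (pow_ne_zero N hx0) y, ← hp]
    exact mul_mem (inv_mem (pow_mem hx N)) (powerSubst_mem_rootField n p)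

theorem mem_puiseuxField {y : Ambient} :
    y ∈ puiseuxField ↔ ∃ n : ℕ+, y ∈ (substRoot n).fieldRange := by
  simp_rw [← rootField_eq_range]
  exact Set.mem_iUnion

theorem powerSubst_mem_puiseuxField (n : ℕ+) (p : PowerSeries ℂ) :
    powerSubst n p ∈ puiseuxField :=
  mem_puiseuxField.2 ⟨n, _, rfl⟩

end Puiseux

/-! ### Polynomials over complete local rings -/

theorem Polynomial.Monic.taylor_coeff_of_natDegree_eq_succ {R : Type*} [CommRing R]
    {f : Polynomial R} (hf : f.Monic) {e : ℕ} (he : f.natDegree = e + 1) (r : R) :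
    (Polynomial.taylor r f).coeff e = f.coeff e + (e + 1) * r := by
  have hd : (Polynomial.hasseDeriv e f).natDegree ≤ 1 :=
    (Polynomial.natDegree_hasseDeriv_le f e).trans (by omega)
  have h1 : f.coeff (1 + e) = 1 := by rw [add_comm, ← he]; exact hf
  rw [Polynomial.taylor_coeff, Polynomial.eq_X_add_C_of_natDegree_le_one hd]
  simp only [Polynomial.hasseDeriv_coeff, h1, Polynomial.eval_add, Polynomial.eval_mul,
    Polynomial.eval_C, Polynomial.eval_X, zero_add, Nat.choose_self]
  rw [add_comm 1 e, Nat.choose_succ_self_right]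
  push_cast
  ring

/-- A polynomial over a complete local ring which vanishes at the origin of the residue
field, but has a nonzero coefficient below its degree there, has a nontrivial monic factor. -/
theorem Polynomial.exists_monic_dvd_of_residue {A : Type*} [CommRing A] [IsLocalRing A]
    [IsAdicComplete (IsLocalRing.maximalIdeal A) A] {g : Polynomial A}
    (h0 : g.coeff 0 ∈ IsLocalRing.maximalIdeal A) {i : ℕ} (hi : i < g.natDegree)
    (hgi : g.coeff i ∉ IsLocalRing.maximalIdeal A) :
    ∃ f : Polynomial A, f.Monic ∧ f ∣ g ∧ 0 < f.natDegree ∧ f.natDegree < g.natDegree := by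
  have hci : PowerSeries.coeff i ((g : PowerSeries A).map (IsLocalRing.residue A)) ≠ 0 := by
    rw [PowerSeries.coeff_map, Polynomial.coeff_coe]
    rwa [Ne, IsLocalRing.residue_eq_zero_iff]
  have hne : (g : PowerSeries A).map (IsLocalRing.residue A) ≠ 0 := by
    intro h; rw [h] at hci; simp at hci
  obtain ⟨f, u, H⟩ := PowerSeries.exists_isWeierstrassFactorization hne
  have hfm := H.isDistinguishedAt.monic
  have hdeg := H.natDegree_eq_toNat_order_map
  have hfin := PowerSeries.order_finite_iff_ne_zero.2 hne
  have hord : ((f.natDegree : ℕ) : ℕ∞) =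
      ((g : PowerSeries A).map (IsLocalRing.residue A)).order := by
    rw [hdeg, ENat.natCast_toNat hfin.ne]
  have hpos : 0 < f.natDegree := by
    rw [Nat.pos_iff_ne_zero]
    intro hz
    rw [hz] at hord
    have := PowerSeries.coeff_order hne
    rw [← hdeg, hz, PowerSeries.coeff_map, Polynomial.coeff_coe, Ne,
      IsLocalRing.residue_eq_zero_iff] at this
    exact this h0
  have hlt : f.natDegree < g.natDegree := by
    have := PowerSeries.order_le i hci
    rw [← hord] at this
    exact lt_of_le_of_lt (by exact_mod_cast this) hi
  refine ⟨f, hfm, ?_, hpos, hlt⟩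
  have hfo : ((f.natDegree : ℕ) : ℕ∞) =
      ((f : PowerSeries A).map (IsLocalRing.residue A)).order :=
    H.isDistinguishedAt.coe_natDegree_eq_order_map (f : PowerSeries A) 1 (by simp) (by simp)
  have hf0 : (f : PowerSeries A).map (IsLocalRing.residue A) ≠ 0 := by
    rw [← PowerSeries.order_finite_iff_ne_zero, ← hfo]
    exact ENat.natCast_lt_top _
  have hfo' : ((f : PowerSeries A).map (IsLocalRing.residue A)).order.toNat = f.natDegree := by
    rw [← hfo, ENat.toNat_natCast]
  -- Euclidean division by the monic `f` is also a Weierstrass division, since the reduction of `f`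
  -- has order equal to its degree. By uniqueness its remainder agrees with that of `g = f * u`,
  -- namely 0, so `f` divides `g` among polynomials.
  have D1 : (g : PowerSeries A).IsWeierstrassDivision f ((g /ₘ f : Polynomial A) : PowerSeries A)
      (g %ₘ f) := by
    refine ⟨?_, ?_⟩
    · refine (Polynomial.degree_modByMonic_lt g hfm).trans_eq ?_
      rw [Polynomial.degree_eq_natDegree hfm.ne_zero]
      exact congrArg _ hfo'.symm
    · rw [← Polynomial.coe_mul, ← Polynomial.coe_add, add_comm, Polynomial.modByMonic_add_div]
  have D2 : (g : PowerSeries A).IsWeierstrassDivision f u 0 := by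
    refine ⟨?_, ?_⟩
    · rw [Polynomial.degree_zero]; exact WithBot.bot_lt_coe _
    · rw [Polynomial.coe_zero, add_zero]; exact H.eq_mul
  exact (Polynomial.modByMonic_eq_zero_iff_dvd hfm).1 (D1.elim hf0 D2).2

theorem Polynomial.exists_monic_coeff_eq {R : Type*} [CommRing R] [Nontrivial R] (d : ℕ)
    (b : ℕ → R) : ∃ g : Polynomial R, g.Monic ∧ g.natDegree = d ∧ ∀ i < d, g.coeff i = b i := by
  set q : Polynomial R := ∑ i ∈ Finset.range d, Polynomial.C (b i) * Polynomial.X ^ i with hq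
  have hc (i : ℕ) : q.coeff i = if i < d then b i else 0 := by
    simp [hq, Polynomial.finsetSum_coeff]
  have hlt : q.degree < d := (Polynomial.degree_lt_iff_coeff_zero q d).2 fun i hi => by
    rw [hc, if_neg (by omega)]
  refine ⟨Polynomial.X ^ d + q, Polynomial.monic_X_pow_add hlt, ?_, fun i hi => ?_⟩
  · refine Polynomial.natDegree_eq_of_degree_eq_some ?_
    rw [Polynomial.degree_add_eq_left_of_degree_lt, Polynomial.degree_X_pow]
    rwa [Polynomial.degree_X_pow]
  · rw [Polynomial.coeff_add, Polynomial.coeff_X_pow, if_neg hi.ne, zero_add, hc, if_pos hi]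

namespace PowerSeries

theorem mem_maximalIdeal_iff_constantCoeff {k : Type*} [Field k] {p : PowerSeries k} :
    p ∈ IsLocalRing.maximalIdeal (PowerSeries k) ↔ constantCoeff p = 0 := by
  rw [IsLocalRing.mem_maximalIdeal, mem_nonunits_iff, isUnit_iff_constantCoeff, isUnit_iff_ne_zero,
    not_not]

instance isAdicComplete_maximalIdeal {k : Type*} [Field k] :
    IsAdicComplete (IsLocalRing.maximalIdeal (PowerSeries k)) (PowerSeries k) := by
  rw [maximalIdeal_eq_span_X]
  infer_instance

end PowerSeries

/-! ### The Newton–Puiseux induction -/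

namespace Puiseux

/-- Every monic polynomial of positive degree less than `d` over some `ℂ[[x^{1/n}]]` has a root
in the field of Puiseux series. -/
def HasRootsBelow (d : ℕ) : Prop :=
  ∀ (n : ℕ+) (f : Polynomial (PowerSeries ℂ)), f.Monic → 0 < f.natDegree → f.natDegree < d →
    ∃ z ∈ puiseuxField, f.eval₂ (powerSubst n) z = 0

theorem exists_root_of_taylor {n : ℕ+} {f : Polynomial (PowerSeries ℂ)} {r : PowerSeries ℂ}
    (h : ∃ z ∈ puiseuxField, (Polynomial.taylor r f).eval₂ (powerSubst n) z = 0) :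
    ∃ z ∈ puiseuxField, f.eval₂ (powerSubst n) z = 0 := by
  obtain ⟨z, hz, h⟩ := h
  refine ⟨z + powerSubst n r, add_mem hz (powerSubst_mem_puiseuxField n r), ?_⟩
  rw [Polynomial.taylor_apply, Polynomial.eval₂_comp] at h
  simpa using h

theorem exists_root_of_constantCoeff_ne_zero {e : ℕ} (ih : HasRootsBelow (e + 1)) (n : ℕ+)
    {g : Polynomial (PowerSeries ℂ)} (hg : g.Monic) (hd : g.natDegree = e + 1)
    (he : g.coeff e = 0) {i : ℕ} (hi : i < e + 1)
    (hgi : PowerSeries.constantCoeff (g.coeff i) ≠ 0) :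
    ∃ z ∈ puiseuxField, g.eval₂ (powerSubst n) z = 0 := by
  set p := g.map PowerSeries.constantCoeff with hp
  have hpm : p.Monic := hg.map _
  have hpd : p.natDegree = e + 1 := by rw [hp, hg.natDegree_map, hd]
  obtain ⟨c, hc⟩ := IsAlgClosed.exists_root p (by
    rw [Polynomial.degree_eq_natDegree hpm.ne_zero, hpd]; exact_mod_cast Nat.succ_ne_zero e)
  have hmap : (Polynomial.taylor (PowerSeries.C c) g).map PowerSeries.constantCoeff =
      Polynomial.taylor c p := by
    rw [Polynomial.map_taylor, PowerSeries.constantCoeff_C]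
  have hcoeff (j : ℕ) : PowerSeries.constantCoeff
      ((Polynomial.taylor (PowerSeries.C c) g).coeff j) = (Polynomial.taylor c p).coeff j := by
    rw [← hmap, Polynomial.coeff_map]
  -- Otherwise $p=(y-c)^{e+1}$; its vanishing subleading coefficient forces $c=0$ in characteristic
  -- zero, so $p=y^{e+1}$, against `hgi`.
  obtain ⟨j, hj, hj0⟩ : ∃ j < e + 1, (Polynomial.taylor c p).coeff j ≠ 0 := by
    by_contra! h
    have h1 := hpm.taylor_coeff_of_natDegree_eq_succ hpd c
    rw [h e (by omega), hp, Polynomial.coeff_map, he, map_zero, zero_add] at h1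
    have hc0 : c = 0 := (mul_eq_zero.1 h1.symm).resolve_left (by exact_mod_cast Nat.succ_ne_zero e)
    have h2 := h i hi
    rw [hc0, Polynomial.taylor_zero, hp, Polynomial.coeff_map] at h2
    exact hgi h2
  have hGd : (Polynomial.taylor (PowerSeries.C c) g).natDegree = e + 1 := by
    rw [Polynomial.natDegree_taylor, hd]
  obtain ⟨f, hfm, hfg, hf0, hfd⟩ := Polynomial.exists_monic_dvd_of_residue
    (g := Polynomial.taylor (PowerSeries.C c) g)
    (by rw [PowerSeries.mem_maximalIdeal_iff_constantCoeff, hcoeff, Polynomial.taylor_coeff_zero]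
        exact hc)
    (i := j) (by rw [hGd]; exact hj)
    (by rw [PowerSeries.mem_maximalIdeal_iff_constantCoeff, hcoeff]; exact hj0)
  obtain ⟨z, hz, hroot⟩ := ih n f hfm hf0 (by rwa [hGd] at hfd)
  exact exists_root_of_taylor ⟨z, hz,
    Polynomial.eval₂_eq_zero_of_dvd_of_eval₂_eq_zero _ _ hfg hroot⟩

/-- After substituting `t ↦ t^k`, a monic polynomial without subleading term is obtained by
scaling the roots of one that does not reduce to a power of the variable. -/
theorem exists_scaleRoots {e : ℕ} {f : Polynomial (PowerSeries ℂ)} (hf : f.Monic)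
    (hd : f.natDegree = e + 1) (he : f.coeff e = 0) (hne : ∃ i < e + 1, f.coeff i ≠ 0) :
    ∃ (k : ℕ+) (v : ℕ) (g : Polynomial (PowerSeries ℂ)), g.Monic ∧ g.natDegree = e + 1 ∧
      g.coeff e = 0 ∧ (∃ i < e + 1, PowerSeries.constantCoeff (g.coeff i) ≠ 0) ∧
      f.map (PowerSeries.expand (k : ℕ) k.ne_zero : PowerSeries ℂ →ₐ[ℂ] PowerSeries ℂ).toRingHom =
        g.scaleRoots (PowerSeries.X ^ v) := by
  classical
  let S := (Finset.range (e + 1)).filter fun i => f.coeff i ≠ 0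
  have hS : S.Nonempty := by
    obtain ⟨i, hi, h⟩ := hne
    exact ⟨i, by simp [S, h]; omega⟩
  -- The minimal ratio $\operatorname{ord}(f_i)/(e+1-i)$ is the smallest Newton slope $v/k$. After
  -- $t\mapsto t^k$, $f_i$ is divisible by $t^{v(e+1-i)}$, with exact order at $i=m$.
  obtain ⟨m, hmS, hmin⟩ := S.exists_min_image
    (fun i => ((f.coeff i).order.toNat : ℚ) / ((e + 1 - i : ℕ) : ℚ)) hS
  obtain ⟨hm, hm0⟩ : m < e + 1 ∧ f.coeff m ≠ 0 := by simpa [S] using hmS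
  let k : ℕ+ := ⟨e + 1 - m, by omega⟩
  set v := (f.coeff m).order.toNat with hv
  have hle (i : ℕ) (hi : i < e + 1) (h0 : f.coeff i ≠ 0) :
      v * (e + 1 - i) ≤ k * (f.coeff i).order.toNat := by
    have := hmin i (by simp [S, h0]; omega)
    have h1 : (0 : ℚ) < ((e + 1 - m : ℕ) : ℚ) := by exact_mod_cast (by omega : 0 < e + 1 - m)
    have h2 : (0 : ℚ) < ((e + 1 - i : ℕ) : ℚ) := by exact_mod_cast (by omega : 0 < e + 1 - i)
    rw [div_le_div_iff₀ h1 h2] at this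
    rw [mul_comm (k : ℕ)]
    exact_mod_cast this
  let E : PowerSeries ℂ →+* PowerSeries ℂ :=
    (PowerSeries.expand (k : ℕ) k.ne_zero : PowerSeries ℂ →ₐ[ℂ] PowerSeries ℂ).toRingHom
  have hdvd (i : ℕ) (hi : i < e + 1) : PowerSeries.X ^ (v * (e + 1 - i)) ∣ E (f.coeff i) := by
    by_cases h0 : f.coeff i = 0
    · rw [h0, map_zero]; exact dvd_zero _
    · refine (pow_dvd_pow _ (hle i hi h0)).trans ?_
      rw [mul_comm, pow_mul']
      have := map_dvd E (PowerSeries.X_pow_order_dvd (φ := f.coeff i))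
      rwa [map_pow, show E PowerSeries.X = PowerSeries.X ^ (k : ℕ) from
        PowerSeries.expand_X _ _] at this
  choose! b hb using hdvd
  obtain ⟨g, hgm, hgd, hgc⟩ := Polynomial.exists_monic_coeff_eq (e + 1) b
  refine ⟨k, v, g, hgm, hgd, ?_, ⟨m, hm, ?_⟩, ?_⟩
  · have := hb e (by omega)
    rw [he, map_zero] at this
    rw [hgc e (by omega)]
    exact (mul_eq_zero.1 this.symm).resolve_left (pow_ne_zero _ PowerSeries.X_ne_zero)
  · have h1 : PowerSeries.coeff ((k : ℕ) * v) (E (f.coeff m)) = PowerSeries.coeff v (f.coeff m) :=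
      PowerSeries.coeff_expand_mul _ _ _ _
    have h2 : v * (e + 1 - m) = (k : ℕ) * v := mul_comm _ _
    rw [hb m hm, h2, PowerSeries.coeff_X_pow_mul', if_pos le_rfl, Nat.sub_self,
      PowerSeries.coeff_zero_eq_constantCoeff_apply] at h1
    rw [hgc m hm, h1]
    exact PowerSeries.coeff_order hm0
  · ext1 i
    rw [Polynomial.coeff_map, Polynomial.coeff_scaleRoots, hgd]
    rcases lt_trichotomy i (e + 1) with hi | rfl | hi
    · rw [hgc i hi, ← pow_mul, mul_comm]
      exact hb i hi
    · have h1 : f.coeff (e + 1) = 1 := by rw [← hd]; exact hf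
      have h2 : g.coeff (e + 1) = 1 := by rw [← hgd]; exact hgm
      rw [h1, h2, map_one, Nat.sub_self, pow_zero, one_mul]
    · rw [Polynomial.coeff_eq_zero_of_natDegree_lt (hd.trans_lt hi),
        Polynomial.coeff_eq_zero_of_natDegree_lt (hgd.trans_lt hi), map_zero, zero_mul]

theorem exists_root_of_coeff_eq_zero {e : ℕ} (ih : HasRootsBelow (e + 1)) (n : ℕ+)
    {f : Polynomial (PowerSeries ℂ)} (hf : f.Monic) (hd : f.natDegree = e + 1)
    (he : f.coeff e = 0) : ∃ z ∈ puiseuxField, f.eval₂ (powerSubst n) z = 0 := by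
  by_cases hne : ∃ i < e + 1, f.coeff i ≠ 0
  · obtain ⟨k, v, g, hgm, hgd, hge, ⟨i, hi, hgi⟩, hfg⟩ := exists_scaleRoots hf hd he hne
    -- The new variable $t$ satisfies $t^k=x^{1/n}$, so the index becomes $nk$.
    obtain ⟨z, hz, h⟩ := exists_root_of_constantCoeff_ne_zero ih (n * k) hgm hgd hge hi hgi
    refine ⟨powerSubst (n * k) (PowerSeries.X ^ v) * z,
      mul_mem (powerSubst_mem_puiseuxField _ _) hz, ?_⟩
    have := Polynomial.scaleRoots_eval₂_eq_zero (powerSubst (n * k)) (s := PowerSeries.X ^ v) h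
    rw [← hfg, Polynomial.eval₂_map] at this
    rwa [show (powerSubst (n * k)).comp (PowerSeries.expand (k : ℕ) k.ne_zero :
      PowerSeries ℂ →ₐ[ℂ] PowerSeries ℂ).toRingHom = powerSubst n from
        RingHom.ext (powerSubst_expand n k)] at this
  · push Not at hne
    refine ⟨0, zero_mem _, ?_⟩
    rw [Polynomial.eval₂_at_zero, hne 0 (by omega), map_zero]

theorem hasRootsBelow (d : ℕ) : HasRootsBelow d := by
  induction d with
  | zero => intro n f _ _ h; exact absurd h (Nat.not_lt_zero _)
  | succ e ih =>
    intro n f hf h0 hlt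
    obtain ⟨d, hd⟩ : ∃ d, f.natDegree = d + 1 := ⟨f.natDegree - 1, by omega⟩
    have ih' : HasRootsBelow (d + 1) := fun n f hf h0 hlt => ih n f hf h0 (by omega)
    -- The Tschirnhaus shift: the new subleading coefficient is `f.coeff d + (d + 1) * r = 0`.
    let r : PowerSeries ℂ := PowerSeries.C (-((d : ℂ) + 1)⁻¹) * f.coeff d
    refine exists_root_of_taylor (r := r) (exists_root_of_coeff_eq_zero ih' n ?_ ?_ ?_)
    · rw [Polynomial.Monic, Polynomial.leadingCoeff_taylor]; exact hf
    · rw [Polynomial.natDegree_taylor, hd]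
    · rw [hf.taylor_coeff_of_natDegree_eq_succ hd]
      have h1 : ((d : PowerSeries ℂ) + 1) = PowerSeries.C ((d : ℂ) + 1) := by simp
      have h2 : ((d : ℂ) + 1) ≠ 0 := by exact_mod_cast Nat.succ_ne_zero d
      rw [h1, ← mul_assoc, ← map_mul, mul_neg, mul_inv_cancel₀ h2, map_neg, map_one]
      ring

/-! ### From power series coefficients to $L^*$ -/

theorem exists_common_index {P : ℕ+ → Ambient → Prop}
    (hP : ∀ n m y, P n y → P (n * m) y) {ι : Type*} (s : Finset ι) (y : ι → Ambient)
    (h : ∀ i ∈ s, ∃ n, P n (y i)) : ∃ n, ∀ i ∈ s, P n (y i) := by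
  classical
  induction s using Finset.induction_on with
  | empty => exact ⟨1, by simp⟩
  | insert a s _ ih =>
    obtain ⟨n, hn⟩ := ih fun i hi => h i (Finset.mem_insert_of_mem hi)
    obtain ⟨m, hm⟩ := h a (Finset.mem_insert_self a s)
    refine ⟨n * m, fun i hi => ?_⟩
    rcases Finset.mem_insert.1 hi with rfl | hi
    · rw [mul_comm]; exact hP _ _ _ hm
    · exact hP _ _ _ (hn i hi)

theorem exists_powerSubst_eq_pow_mul {n : ℕ+} {y : Ambient} (hy : y ∈ (substRoot n).fieldRange) :
    ∃ N : ℕ, ∀ M ≥ N, ∃ p : PowerSeries ℂ, powerSubst n p = xRoot n ^ M * y := by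
  obtain ⟨N, p, hp⟩ := exists_powerSubst_eq_xRoot_pow_mul hy
  refine ⟨N, fun M hM => ⟨PowerSeries.X ^ (M - N) * p, ?_⟩⟩
  rw [map_mul, map_pow, powerSubst_X, hp, ← mul_assoc, ← pow_add, Nat.sub_add_cancel hM]

theorem exists_root {p : Polynomial puiseuxField} (hp : p.Monic) (hd : 0 < p.natDegree) :
    ∃ z, p.eval z = 0 := by
  set d := p.natDegree with hdd
  obtain ⟨n, hn⟩ := exists_common_index (P := fun n y => y ∈ (substRoot n).fieldRange)
    (fun n m y hy => range_substRoot_le_mul n m hy) (Finset.range d)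
    (fun i => (p.coeff i : Ambient)) (fun i _ => mem_puiseuxField.1 (p.coeff i).2)
  have hN : ∀ i, ∃ N : ℕ, i < d → ∀ M ≥ N, ∃ q : PowerSeries ℂ,
      powerSubst n q = xRoot n ^ M * (p.coeff i : Ambient) := fun i => by
    by_cases hi : i < d
    · obtain ⟨N, hN⟩ := exists_powerSubst_eq_pow_mul (hn i (Finset.mem_range.2 hi))
      exact ⟨N, fun _ => hN⟩
    · exact ⟨0, fun h => absurd h hi⟩
  choose N hN using hN
  -- The sum serves as a common upper bound: as $d-i\ge 1$, scaling the roots by $x^{M/n}$ clears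
  -- the denominator of every coefficient.
  set M := ∑ i ∈ Finset.range d, N i with hM
  have hq : ∀ i, ∃ q : PowerSeries ℂ, i < d →
      powerSubst n q = (p.coeff i : Ambient) * (xRoot n ^ M) ^ (d - i) := fun i => by
    by_cases hi : i < d
    · have h1 : N i ≤ M := Finset.single_le_sum (fun _ _ => Nat.zero_le _) (Finset.mem_range.2 hi)
      obtain ⟨q, hq⟩ := hN i hi (M * (d - i))
        (h1.trans (Nat.le_mul_of_pos_right M (by omega)))
      exact ⟨q, fun _ => by rw [hq, pow_mul, mul_comm]⟩
    · exact ⟨0, fun h => absurd h hi⟩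
  choose q hq using hq
  obtain ⟨g, hgm, hgd, hgc⟩ := Polynomial.exists_monic_coeff_eq d q
  obtain ⟨z, hz, hroot⟩ := hasRootsBelow (d + 1) n g hgm (hgd ▸ hd) (by omega)
  have hx : xRoot n ∈ puiseuxField := powerSubst_X n ▸ powerSubst_mem_puiseuxField n _
  let s : puiseuxField := ⟨xRoot n ^ M, pow_mem hx M⟩
  have hs : s ≠ 0 := by
    refine Subtype.coe_injective.ne_iff.1 (?_ : xRoot n ^ M ≠ 0)
    exact pow_ne_zero _ (HahnSeries.single_ne_zero one_ne_zero)
  have hmap : g.map (powerSubst n) = (p.scaleRoots s).map puiseuxField.subtype := by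
    ext1 i
    rw [Polynomial.coeff_map, Polynomial.coeff_map, Polynomial.coeff_scaleRoots, ← hdd, map_mul,
      map_pow]
    rcases lt_trichotomy i d with hi | rfl | hi
    · rw [hgc i hi, hq i hi]; rfl
    · have h1 : g.coeff d = 1 := by rw [← hgd]; exact hgm
      have h2 : p.coeff d = 1 := hp
      rw [h1, h2, map_one, map_one, Nat.sub_self, pow_zero, one_mul]
    · rw [Polynomial.coeff_eq_zero_of_natDegree_lt (hgd.trans_lt hi),
        Polynomial.coeff_eq_zero_of_natDegree_lt hi, map_zero, map_zero, zero_mul]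
  have hroot' : (p.scaleRoots s).eval ⟨z, hz⟩ = 0 := by
    apply puiseuxField.subtype.injective
    rw [map_zero, ← Polynomial.eval₂_at_apply, ← Polynomial.eval_map, ← hmap, Polynomial.eval_map]
    exact hroot
  refine ⟨⟨z, hz⟩ / s, ?_⟩
  have := Polynomial.scaleRoots_eval_mul p (⟨z, hz⟩ / s) s
  rw [mul_div_cancel₀ _ hs, hroot'] at this
  exact (mul_eq_zero.1 this.symm).resolve_left (pow_ne_zero _ hs)

instance isAlgClosed_puiseuxField : IsAlgClosed puiseuxField :=
  IsAlgClosed.of_exists_root _ fun _ hp hirr => exists_root hp hirr.natDegree_pos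

/-! ### Integrality of the roots and the factorization -/

/-- Hahn series without negative exponents form an integrally closed ring. -/
theorem orderTop_nonneg_of_monic_root {H : Polynomial Ambient} (hH : H.Monic)
    (hc : ∀ i, 0 ≤ (H.coeff i).orderTop) {z : Ambient} (hz : H.eval z = 0) :
    0 ≤ z.orderTop := by
  -- The series with `0 ≤ orderTop` form the valuation ring of `v`, and valuation rings are
  -- integrally closed.
  let v := (HahnSeries.addVal ℚ ℂ).toValuation
  have hv (y : Ambient) : y ∈ v.integer ↔ 0 ≤ y.orderTop := by
    rw [← HahnSeries.addVal_apply]; rfl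
  have hsub : (↑H.coeffs : Set Ambient) ⊆ v.integer := by
    intro y hy
    obtain ⟨i, _, rfl⟩ := Polynomial.mem_coeffs_iff.1 (Finset.mem_coe.1 hy)
    exact (hv _).2 (hc i)
  have hint : IsIntegral v.integer z := by
    refine ⟨H.toSubring v.integer hsub, (Polynomial.monic_toSubring _ _ _).2 hH, ?_⟩
    have hmap : (H.toSubring v.integer hsub).map (algebraMap v.integer Ambient) = H :=
      Polynomial.map_toSubring _ _ _
    rw [← Polynomial.eval_map, hmap, hz]
  exact (hv z).1 ((Valuation.integer.integers v).mem_of_integral hint)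

theorem exists_powerSeriesRing_of_roots {h : Polynomial puiseuxField} (hh : h.Monic)
    (hc : ∀ i, (h.coeff i : Ambient) ∈ powerSeriesRing 1) {ι : Type*} [Fintype ι]
    (σ : ι → puiseuxField) (hσ : ∀ i, h.eval (σ i) = 0) :
    ∃ n : ℕ+, ∀ i, (σ i : Ambient) ∈ powerSeriesRing n := by
  obtain ⟨n, hn⟩ := exists_common_index (P := fun n y => y ∈ powerSeriesRing n)
    (fun n m y hy => powerSeriesRing_le_mul n m hy) Finset.univ (fun i => (σ i : Ambient))
    (fun i _ => by
      obtain ⟨n, hn⟩ := mem_puiseuxField.1 (σ i).2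
      refine ⟨n, mem_powerSeriesRing_of_orderTop_nonneg hn ?_⟩
      refine orderTop_nonneg_of_monic_root (hh.map puiseuxField.subtype) (fun j => ?_) ?_
      · rw [Polynomial.coeff_map]
        exact orderTop_nonneg_of_mem_powerSeriesRing (hc j)
      · have := congrArg puiseuxField.subtype (hσ i)
        rwa [map_zero, ← Polynomial.eval₂_at_apply, ← Polynomial.eval_map] at this)
  exact ⟨n, fun i => hn i (Finset.mem_univ i)⟩

end Puiseux

theorem Polynomial.Monic.exists_eq_prod_X_sub_C {k : Type*} [Field k] [IsAlgClosed k]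
    {h : Polynomial k} (hh : h.Monic) :
    ∃ σ : Fin h.natDegree → k, h = ∏ i, (Polynomial.X - Polynomial.C (σ i)) := by
  have hs := IsAlgClosed.splits h
  have hlen : h.roots.toList.length = h.natDegree := by
    rw [Multiset.length_toList, hs.natDegree_eq_card_roots]
  refine ⟨fun i => h.roots.toList.get (i.cast hlen.symm), ?_⟩
  conv_lhs => rw [hs.eq_prod_roots_of_monic hh, ← Multiset.coe_toList h.roots]
  have hprod (l : List k) : (l.map fun a => Polynomial.X - Polynomial.C a).prod =
      ∏ i : Fin l.length, (Polynomial.X - Polynomial.C (l.get i)) := by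
    conv_lhs => rw [← List.ofFn_get l, List.map_ofFn, List.prod_ofFn]
    rfl
  rw [Multiset.map_coe, Multiset.prod_coe, hprod]
  exact Fintype.prod_equiv (finCongr hlen) _ _ fun i => rfl

end

theorem mainTheorem3 (h : Polynomial Puiseux.puiseuxField) (hh : h.Monic) :
    ∃ σ : Fin h.natDegree → Puiseux.puiseuxField,
      h = ∏ i, (Polynomial.X - Polynomial.C (σ i)) ∧
      ((∀ i, (h.coeff i : Puiseux.Ambient) ∈ Puiseux.powerSeriesRing 1) →
        ∃ n : ℕ+, ∀ i, (σ i : Puiseux.Ambient) ∈ Puiseux.powerSeriesRing n) := by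
  obtain ⟨σ, hσ⟩ := hh.exists_eq_prod_X_sub_C
  refine ⟨σ, hσ, fun hc => Puiseux.exists_powerSeriesRing_of_roots hh hc σ fun i => ?_⟩
  have hdvd : Polynomial.X - Polynomial.C (σ i) ∣ h := by
    conv_rhs => rw [hσ]
    exact Finset.dvd_prod_of_mem _ (Finset.mem_univ i)
  exact Polynomial.dvd_iff_isRoot.1 hdvd
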